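/- Let $\Gamma=\mathrm{Gal}(\mathbb C/\mathbb R)=\{1,\gamma\}$, where $\gamma$ is complex conjugation. Let $H$ be a unipotent linear algebraic group over $\mathbb C$ (identified with its group of $\mathbb C$-points), and let $$1\to H\to E\to\Gamma\to 1$$ be an extension of abstract groups such that every element of the preimage $E_\gamma\subset E$ of $\gamma$ acts on $H$ by conjugation as an anti-regular automorphism; here a map $\varphi\colon H\to H$ is called anti-regular if for every regular function $f$ on $H$ the function $h\mapsto\overline{f(\varphi(h))}$ is regular. A splitting element of $E$ is an element $x\in E_\gamma$ with $x^2=1$. Then: (1) there exists a splitting element in $E$; (2) any two splitting elements of $E$ are conjugate in $E$; (3) explicitly, for every $x\in E_\gamma$ we have $x^2\in H$, and if $r=\exp\bigl(\tfrac12\log(x^2)\bigr)\in H$, where $\exp\colon \mathrm{Lie}(H)\to H$ and its inverse $\log\colon H\to\mathrm{Lie}(H)$ are the exponential and logarithm maps of the unipotent group $H$, then $x_0=r^{-1}x$ is a splitting element of $E$. -/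

import Mathlib

open scoped ComplexConjugate

/-- A linear algebraic group over `ℂ`, in the classical language: an abstract group `H` (the group
of complex points) with a finitely generated algebra of complex valued functions on it (the regular
functions), for which `H` is the set of points of the corresponding affine variety, and for which
multiplication and inversion are regular maps. -/
class ComplexAlgebraicGroup (H : Type*) [Group H] where
  /-- The algebra of regular functions. -/
  regular : Subalgebra ℂ (H → ℂ)
  regular_fg : regular.FG
  /-- The points of `H` are exactly the `ℂ`-algebra homomorphisms from the algebra of regular
  functions to `ℂ`, through evaluation. -/
  eval_bijective : Function.Bijective
    (fun h : H => ((Pi.evalAlgHom ℂ (fun _ : H => ℂ) h).comp regular.val : regular →ₐ[ℂ] ℂ))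
  /-- Multiplication `H × H → H` is regular: it pulls a regular function back to a finite sum of
  products of a regular function of `x` and a regular function of `y`. -/
  mul_regular : ∀ f ∈ regular, ∃ (n : ℕ) (a b : Fin n → H → ℂ),
    (∀ i, a i ∈ regular) ∧ (∀ i, b i ∈ regular) ∧
      ∀ x y : H, f (x * y) = ∑ i, a i x * b i y
  /-- Inversion `H → H` is regular. -/
  inv_regular : ∀ f ∈ regular, (fun x : H => f x⁻¹) ∈ regular

namespace ComplexAlgebraicGroup

/-- The algebra of regular functions on `H`. -/
abbrev CoordRing (H : Type*) [Group H] [ComplexAlgebraicGroup H] : Type _ :=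
  ↥(regular : Subalgebra ℂ (H → ℂ))

variable {H : Type*} [Group H] [ComplexAlgebraicGroup H]

theorem rightTranslate_mem (h : H) {f : H → ℂ} (hf : f ∈ (regular : Subalgebra ℂ (H → ℂ))) :
    (fun g => f (g * h)) ∈ (regular : Subalgebra ℂ (H → ℂ)) := by
  obtain ⟨n, a, b, ha, -, hab⟩ := mul_regular f hf
  have : (fun g => f (g * h)) = ∑ i, (b i h) • a i := by
    funext g
    simp [hab, mul_comm]
  rw [this]
  exact Subalgebra.sum_mem _ fun i _ => Subalgebra.smul_mem _ (ha i) _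

theorem leftTranslate_mem (h : H) {f : H → ℂ} (hf : f ∈ (regular : Subalgebra ℂ (H → ℂ))) :
    (fun g => f (h * g)) ∈ (regular : Subalgebra ℂ (H → ℂ)) := by
  obtain ⟨n, a, b, -, hb, hab⟩ := mul_regular f hf
  have : (fun g => f (h * g)) = ∑ i, (a i h) • b i := by
    funext g
    simp [hab]
  rw [this]
  exact Subalgebra.sum_mem _ fun i _ => Subalgebra.smul_mem _ (hb i) _

/-- Right translation by `h` on regular functions: `(rightTranslate h f) g = f (g * h)`. -/
def rightTranslate (h : H) : Module.End ℂ (CoordRing H) where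
  toFun f := ⟨fun g => f.1 (g * h), rightTranslate_mem h f.2⟩
  map_add' _ _ := rfl
  map_smul' _ _ := rfl

/-- Left translation by `h` on regular functions: `(leftTranslate h f) g = f (h * g)`. -/
def leftTranslate (h : H) : Module.End ℂ (CoordRing H) where
  toFun f := ⟨fun g => f.1 (h * g), leftTranslate_mem h f.2⟩
  map_add' _ _ := rfl
  map_smul' _ _ := rfl

/-- An element `h` is unipotent if right translation by `h` is a locally unipotent operator on the
algebra of regular functions. -/
def IsUnipotentElement (h : H) : Prop :=
  ∀ f : CoordRing H, ∃ n : ℕ, ((rightTranslate h - 1) ^ n) f = 0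

variable (H) in
/-- An algebraic group is unipotent if all its elements are unipotent. -/
def IsUnipotent : Prop := ∀ h : H, IsUnipotentElement h

/-- A map `φ : H → H` is anti-regular if for every regular function `f` the function
`x ↦ conj (f (φ x))` is regular. -/
def IsAntiRegular (φ : H → H) : Prop :=
  ∀ f ∈ (regular : Subalgebra ℂ (H → ℂ)),
    (fun x => conj (f (φ x))) ∈ (regular : Subalgebra ℂ (H → ℂ))

variable (H) in
/-- The Lie algebra of `H`: the derivations of the algebra of regular functions that commute with
all left translations. -/
def lieAlgebra : LieSubalgebra ℂ (Derivation ℂ (CoordRing H) (CoordRing H)) where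
  carrier := {D | ∀ (h : H) (f : CoordRing H), D (leftTranslate h f) = leftTranslate h (D f)}
  add_mem' := by
    intro D D' hD hD' h f
    simp [hD h f, hD' h f]
  zero_mem' := by
    intro h f
    simp
  smul_mem' := by
    intro c D hD h f
    simp [hD h f]
  lie_mem' := by
    intro D D' hD hD' h f
    simp only [Derivation.commutator_apply, map_sub]
    rw [hD' h f, hD h f, hD h, hD' h]

/-- `IsExp X h` says that `h = exp X`, for a locally nilpotent element `X` of the Lie algebra
(in a unipotent group every `X` is locally nilpotent): `f h = ∑ₖ (X ^ k f)(1) / k!` for every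
regular function `f`, where the sum is finite. On a unipotent group, `X = log h` means the same. -/
def IsExp (X : lieAlgebra H) (h : H) : Prop :=
  ∀ f : CoordRing H, ∃ n : ℕ,
    ((X : Derivation ℂ (CoordRing H) (CoordRing H)).toLinearMap ^ n) f = 0 ∧
    f.1 h = ∑ k ∈ Finset.range n, ((k.factorial : ℂ)⁻¹) *
      (((X : Derivation ℂ (CoordRing H) (CoordRing H)).toLinearMap ^ k) f).1 1

end ComplexAlgebraicGroup

/-- For an extension `1 → H → E → Gal(ℂ/ℝ) → 1`, the preimage in `E` of complex conjugation. -/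
def preimageConj {H E : Type*} [Group H] [Group E] (S : GroupExtension H E (ℂ ≃ₐ[ℝ] ℂ)) : Set E :=
  {x | S.rightHom x = Complex.conjAe}

/-- A splitting element of an extension `1 → H → E → Gal(ℂ/ℝ) → 1`: an element of square one over
complex conjugation. -/
def IsSplittingElement {H E : Type*} [Group H] [Group E] (S : GroupExtension H E (ℂ ≃ₐ[ℝ] ℂ))
    (x : E) : Prop :=
  x ∈ preimageConj S ∧ x ^ 2 = 1

/-!
The extension splits, and its splittings are conjugate, because `H` has unique square roots:
squaring is injective on `H`, and the square root of `h` is `exp (½ log h)`.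

Granting this, let `x` lie over complex conjugation and write `σ` for conjugation by `x` on `H`.
The square root `r` of `h = x²` is fixed by `σ`, since `σ h = h`; hence `r` commutes with `x` and
`r⁻¹ x` has square one (`isSplittingElement_inv_mul`). If `x² = 1` and `h x` is another splitting
element, then `σ h = h⁻¹`, so the square root `r` of `h` satisfies `σ r = r⁻¹`, and
`r x r⁻¹ = r² x = h x` (`isConj_of_isSplittingElement`).

Injectivity of squaring (`IsUnipotent.sq_injective`): modulo `(X - 1) ^ n` the polynomial `X` is a
polynomial in `X ^ 2`, so a locally unipotent operator, here right translation on regular functions,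
is locally a polynomial in its square.

The logarithm of `h` (`IsUnipotentElement.exists_isExp`): since right translation by `h` is
locally unipotent, `m ↦ f (g * h ^ m)` is given by a polynomial in `m`
(`IsUnipotentElement.orbitPoly`), and `log h` is the derivation sending `f` to
`g ↦ d/dm f (g * h ^ m)` at `m = 0`. All its properties follow from the fact that a complex
polynomial is determined by its values at natural numbers.

The exponential (`expAlgHom`): for a locally nilpotent derivation `D`, the map sending `f` to
the polynomial `∑ₖ (Dᵏ f)(1) tᵏ / k!` is multiplicative by the Leibniz rule, so its value at `t` is
evaluation at a point of `H`, which is `exp (t D)`. For a left invariant `D` these points form a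
one-parameter group, whence `exp (½ X)` is a square root of `exp X` (`IsExp.exists_isExp_half`).
-/

section

open Polynomial

/-! ### Square roots of locally unipotent operators -/

/-- Modulo `(X - 1) ^ n`, the polynomial `X` is a polynomial in `X ^ 2`. -/
theorem exists_sub_one_pow_dvd_comp_sq_sub_X (n : ℕ) :
    ∃ p : ℂ[X], (X - 1) ^ n ∣ p.comp (X ^ 2) - X := by
  induction n with
  | zero => exact ⟨0, by simp⟩
  | succ n ih =>
    obtain ⟨p, q, hq⟩ := ih
    -- Newton step: `(X - 1) ^ n` evaluated at `X ^ 2` is `(X - 1) ^ n * (X + 1) ^ n`, and the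
    -- constant is chosen so that the new cofactor vanishes at `1`.
    have h1 : (X - C 1 : ℂ[X]) ∣ q - C (q.eval 1 / 2 ^ n) * (X + 1) ^ n := by
      rw [dvd_iff_isRoot]
      have : (2 : ℂ) ^ n ≠ 0 := pow_ne_zero n two_ne_zero
      norm_num [IsRoot, this]
    obtain ⟨s, hs⟩ := h1
    refine ⟨p - C (q.eval 1 / 2 ^ n) * (X - 1) ^ n, s, ?_⟩
    have h2 : (X ^ 2 - 1 : ℂ[X]) ^ n = (X - 1) ^ n * (X + 1) ^ n := by
      rw [← mul_pow]; ring
    rw [sub_comp, mul_comp, pow_comp, sub_comp, X_comp, C_comp, one_comp, h2, sub_right_comm, hq,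
      pow_succ, mul_assoc, show (X - 1 : ℂ[X]) = X - C 1 by simp, ← hs]
    ring

/-- A vector on which both `u` and `v` are unipotent cannot distinguish them if `u ^ 2 = v ^ 2`. -/
theorem Module.End.apply_eq_of_sq_eq_sq {V : Type*} [AddCommGroup V] [Module ℂ V]
    {u v : Module.End ℂ V} (huv : u ^ 2 = v ^ 2) {x : V} {m n : ℕ}
    (hu : ((u - 1) ^ m) x = 0) (hv : ((v - 1) ^ n) x = 0) : u x = v x := by
  obtain ⟨p, q, hq⟩ := exists_sub_one_pow_dvd_comp_sq_sub_X (m + n)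
  have key : ∀ w : Module.End ℂ V, ((w - 1) ^ (m + n)) x = 0 → aeval (w ^ 2) p x = w x := by
    intro w hw
    have := congrArg (fun r => aeval w r x) hq
    simp only [aeval_sub, aeval_comp, map_pow, aeval_X, mul_comm _ q, aeval_mul, aeval_one,
      Module.End.mul_apply, LinearMap.sub_apply, hw, map_zero] at this
    exact sub_eq_zero.1 this
  rw [← key u (by rw [add_comm, pow_add, Module.End.mul_apply, hu, map_zero]),
    ← key v (by rw [pow_add, Module.End.mul_apply, hv, map_zero]), huv]

/-! ### Complex polynomials and iterated derivations -/

/-- A complex polynomial is determined by its values at natural numbers. -/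
theorem Polynomial.eq_of_eval_natCast_eq {p q : ℂ[X]}
    (h : ∀ m : ℕ, p.eval (m : ℂ) = q.eval (m : ℂ)) : p = q :=
  eq_of_infinite_eval_eq p q <|
    (Set.infinite_range_of_injective (Nat.cast_injective (R := ℂ))).mono <| by
      rintro _ ⟨m, rfl⟩
      exact h m

/-- The coefficients of a polynomial are its derivatives at `0`, divided by factorials. -/
theorem Polynomial.coeff_eq_inv_factorial_mul_eval_iterate_derivative (p : ℂ[X]) (k : ℕ) :
    p.coeff k = ((k.factorial : ℂ)⁻¹) * (derivative^[k] p).eval 0 := by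
  rw [← coeff_zero_eq_eval_zero, coeff_iterate_derivative]
  simp [Nat.descFactorial_self, Nat.factorial_ne_zero]

theorem Polynomial.eval_eq_sum_range_of_coeff_eq_zero {p : ℂ[X]} {n : ℕ}
    (h : ∀ k, n ≤ k → p.coeff k = 0) (t : ℂ) :
    p.eval t = ∑ k ∈ Finset.range n, p.coeff k * t ^ k := by
  rw [eval_eq_sum, sum_def]
  refine Finset.sum_subset (fun k hk => ?_) (fun k _ hk => ?_)
  · by_contra hkn
    exact mem_support_iff.1 hk (h k (by simpa using hkn))
  · rw [notMem_support_iff.1 hk, zero_mul]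

/-- The Leibniz rule for iterates of a derivation, with the binomial coefficients absorbed in
divided powers. -/
theorem Derivation.inv_factorial_smul_pow_mul {A : Type*} [CommRing A] [Algebra ℂ A]
    (D : Derivation ℂ A A) (n : ℕ) (a b : A) :
    ((n.factorial : ℂ)⁻¹) • (D.toLinearMap ^ n) (a * b) =
      ∑ ij ∈ Finset.HasAntidiagonal.antidiagonal n,
        (((ij.1.factorial : ℂ)⁻¹) • (D.toLinearMap ^ ij.1) a) *
        (((ij.2.factorial : ℂ)⁻¹) • (D.toLinearMap ^ ij.2) b) := by
  have h : (D.toLinearMap ^ n) (a * b) = ∑ ij ∈ Finset.HasAntidiagonal.antidiagonal n,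
      n.choose ij.1 • ((D.toLinearMap ^ ij.1) a * (D.toLinearMap ^ ij.2) b) := by
    induction n with
    | zero => simp
    | succ n ih =>
      rw [Finset.sum_antidiagonal_choose_succ_nsmul
        (fun i j => (D.toLinearMap ^ i) a * (D.toLinearMap ^ j) b) n, pow_succ',
        Module.End.mul_apply, ih, map_sum, ← Finset.sum_add_distrib]
      refine Finset.sum_congr rfl fun ij hij => ?_
      rw [n.choose_symm_of_eq_add (Finset.HasAntidiagonal.mem_antidiagonal.1 hij).symm,
        map_nsmul, ← smul_add]
      congr 1
      simp only [pow_succ', Module.End.mul_apply, Derivation.coeFn_coe, Derivation.leibniz,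
        smul_eq_mul]
      ring
  rw [h, Finset.smul_sum]
  refine Finset.sum_congr rfl fun ij hij => ?_
  obtain rfl := Finset.HasAntidiagonal.mem_antidiagonal.1 hij
  rw [smul_mul_smul_comm, ← Nat.cast_smul_eq_nsmul ℂ, smul_smul,
    Nat.cast_add_choose]
  congr 1
  have := Nat.factorial_ne_zero (ij.1 + ij.2)
  field_simp

namespace ComplexAlgebraicGroup

variable {H : Type*} [Group H] [ComplexAlgebraicGroup H]

/-! ### Points and translations -/

theorem eq_of_forall_regular_eq {a b : H} (h : ∀ f : CoordRing H, f.1 a = f.1 b) : a = b :=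
  eval_bijective.1 (AlgHom.ext h)

theorem exists_point (φ : CoordRing H →ₐ[ℂ] ℂ) : ∃ h : H, ∀ f : CoordRing H, f.1 h = φ f := by
  obtain ⟨h, hh⟩ := eval_bijective.2 φ
  exact ⟨h, fun f => DFunLike.congr_fun hh f⟩

theorem rightTranslate_mul (a b : H) :
    rightTranslate (a * b) = rightTranslate a * rightTranslate b := by
  refine LinearMap.ext fun f => Subtype.ext (funext fun g => ?_)
  exact congrArg f.1 (mul_assoc g a b).symm

theorem rightTranslate_pow (a : H) (n : ℕ) : rightTranslate (a ^ n) = rightTranslate a ^ n := by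
  induction n with
  | zero =>
    refine LinearMap.ext fun f => Subtype.ext (funext fun g => ?_)
    simp [rightTranslate]
  | succ n ih => rw [pow_succ, rightTranslate_mul, ih, pow_succ]

theorem IsUnipotent.sq_injective (hH : IsUnipotent H) :
    Function.Injective (fun h : H => h ^ 2) := by
  intro a b hab
  refine eq_of_forall_regular_eq fun f => ?_
  obtain ⟨m, hm⟩ := hH a f
  obtain ⟨n, hn⟩ := hH b f
  have h2 : rightTranslate a ^ 2 = rightTranslate b ^ 2 := by
    rw [← rightTranslate_pow, ← rightTranslate_pow]
    exact congrArg rightTranslate hab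
  have := congrArg (fun F : CoordRing H => F.1 1) (Module.End.apply_eq_of_sq_eq_sq h2 hm hn)
  simpa [rightTranslate] using this

/-! ### The logarithm of a unipotent element -/

theorem coe_sum_smul_apply {ι : Type*} (s : Finset ι) (c : ι → ℂ) (F : ι → CoordRing H) (g : H) :
    (∑ i ∈ s, c i • F i : CoordRing H).1 g = ∑ i ∈ s, c i * (F i).1 g := by
  simp

/-- The polynomial `t ↦ binom(t, k)`. -/
noncomputable def binomPoly (k : ℕ) : ℂ[X] := C ((k.factorial : ℂ)⁻¹) * descPochhammer ℂ k

theorem binomPoly_eval_natCast (k m : ℕ) : (binomPoly k).eval (m : ℂ) = m.choose k := by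
  rw [binomPoly, eval_mul, eval_C, descPochhammer_eval_eq_descFactorial,
    Nat.descFactorial_eq_factorial_mul_choose, Nat.cast_mul, inv_mul_cancel_left₀]
  exact_mod_cast k.factorial_ne_zero

namespace IsUnipotentElement

variable {h : H} (hh : IsUnipotentElement h)

/-- The polynomial `∑ₖ binom(t, k) ((R - 1)ᵏ f)(g)`, where `R` is right translation by `h`. It
interpolates `m ↦ f (g * h ^ m)`, and so stands for `t ↦ f (g * exp (t log h))`. -/
noncomputable def orbitPoly (f : CoordRing H) (g : H) : ℂ[X] :=
  ∑ k ∈ Finset.range (hh f).choose, C ((((rightTranslate h - 1) ^ k) f).1 g) * binomPoly k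

theorem orbitPoly_eval (f : CoordRing H) (g : H) (m : ℕ) :
    (hh.orbitPoly f g).eval (m : ℂ) = f.1 (g * h ^ m) := by
  have hn := (hh f).choose_spec
  set n := (hh f).choose with hn'
  have h1 : f.1 (g * h ^ m) = ((rightTranslate h ^ m) f).1 g := by
    rw [← rightTranslate_pow]; rfl
  -- the binomial sum up to `m` and the one up to `n` agree with the one up to `m + n`
  have h2 : ((rightTranslate h ^ m) f) =
      ∑ k ∈ Finset.range (m + 1), (m.choose k : ℂ) • ((rightTranslate h - 1) ^ k) f := by
    conv_lhs => rw [← sub_add_cancel (rightTranslate h) 1, (Commute.one_right _).add_pow]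
    simp only [one_pow, mul_one, LinearMap.sum_apply]
    refine Finset.sum_congr rfl fun k _ => ?_
    rw [← Nat.cast_comm, ← nsmul_eq_mul, LinearMap.smul_apply, Nat.cast_smul_eq_nsmul]
  rw [h1, h2, coe_sum_smul_apply, orbitPoly, eval_finsetSum, ← hn']
  simp only [eval_mul, eval_C, binomPoly_eval_natCast]
  have h3 : ∑ k ∈ Finset.range n, (((rightTranslate h - 1) ^ k) f).1 g * (m.choose k : ℂ) =
      ∑ k ∈ Finset.range (m + 1 + n),
        (((rightTranslate h - 1) ^ k) f).1 g * (m.choose k : ℂ) := by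
    refine Finset.sum_subset (Finset.range_mono (by omega)) fun k _ hk => ?_
    obtain ⟨j, rfl⟩ := Nat.exists_eq_add_of_le' (by simpa using hk : n ≤ k)
    rw [pow_add, Module.End.mul_apply, hn, map_zero]
    simp
  have h4 : ∑ k ∈ Finset.range (m + 1), (m.choose k : ℂ) * (((rightTranslate h - 1) ^ k) f).1 g =
      ∑ k ∈ Finset.range (m + 1 + n),
        (m.choose k : ℂ) * (((rightTranslate h - 1) ^ k) f).1 g := by
    refine Finset.sum_subset (Finset.range_mono (by omega)) fun k _ hk => ?_
    rw [Nat.choose_eq_zero_of_lt (by simpa using hk)]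
    simp
  rw [h3, h4]
  exact Finset.sum_congr rfl fun k _ => mul_comm _ _

/-- The degree of `orbitPoly f g` is bounded independently of `g`. -/
theorem exists_orbitPoly_coeff_eq_zero (f : CoordRing H) :
    ∃ n : ℕ, ∀ g k, n ≤ k → (hh.orbitPoly f g).coeff k = 0 := by
  refine ⟨∑ i ∈ Finset.range (hh f).choose, ((binomPoly i).natDegree + 1), fun g k hk => ?_⟩
  rw [orbitPoly, finsetSum_coeff]
  refine Finset.sum_eq_zero fun i hi => ?_
  rw [coeff_C_mul, coeff_eq_zero_of_natDegree_lt, mul_zero]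
  have := Finset.single_le_sum (f := fun i => (binomPoly i).natDegree + 1)
    (fun _ _ => Nat.zero_le _) hi
  omega

theorem orbitPoly_add (f₁ f₂ : CoordRing H) (g : H) :
    hh.orbitPoly (f₁ + f₂) g = hh.orbitPoly f₁ g + hh.orbitPoly f₂ g :=
  eq_of_eval_natCast_eq fun m => by simp [orbitPoly_eval]

theorem orbitPoly_smul (c : ℂ) (f : CoordRing H) (g : H) :
    hh.orbitPoly (c • f) g = c • hh.orbitPoly f g :=
  eq_of_eval_natCast_eq fun m => by simp [orbitPoly_eval]

theorem orbitPoly_mul (f₁ f₂ : CoordRing H) (g : H) :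
    hh.orbitPoly (f₁ * f₂) g = hh.orbitPoly f₁ g * hh.orbitPoly f₂ g :=
  eq_of_eval_natCast_eq fun m => by simp [orbitPoly_eval]

theorem orbitPoly_leftTranslate (a : H) (f : CoordRing H) (g : H) :
    hh.orbitPoly (leftTranslate a f) g = hh.orbitPoly f (a * g) :=
  eq_of_eval_natCast_eq fun m => by
    rw [orbitPoly_eval, orbitPoly_eval, mul_assoc]
    rfl

theorem orbitPoly_mul_pow (f : CoordRing H) (g : H) (m : ℕ) :
    hh.orbitPoly f (g * h ^ m) = taylor (m : ℂ) (hh.orbitPoly f g) :=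
  eq_of_eval_natCast_eq fun l => by
    rw [taylor_eval, ← Nat.cast_add, orbitPoly_eval, orbitPoly_eval, mul_assoc, ← pow_add, add_comm]

theorem orbitPoly_coeff_zero (f : CoordRing H) (g : H) :
    (hh.orbitPoly f g).coeff 0 = f.1 g := by
  have := hh.orbitPoly_eval f g 0
  simpa [coeff_zero_eq_eval_zero] using this

theorem exists_orbitPoly_coeff_one (f : CoordRing H) :
    ∃ F : CoordRing H, ∀ g, F.1 g = (hh.orbitPoly f g).coeff 1 := by
  refine ⟨∑ k ∈ Finset.range (hh f).choose,
    (binomPoly k).coeff 1 • ((rightTranslate h - 1) ^ k) f, fun g => ?_⟩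
  rw [coe_sum_smul_apply, orbitPoly, finsetSum_coeff]
  exact Finset.sum_congr rfl fun k _ => by rw [coeff_C_mul, mul_comm]

/-- The logarithm of a unipotent element `h`, as a derivation of the algebra of regular functions:
it sends `f` to `g ↦ d/dt f (g * exp (t log h))` at `t = 0`. -/
noncomputable def logDerivation : Derivation ℂ (CoordRing H) (CoordRing H) :=
  Derivation.mk'
    { toFun := fun f => (hh.exists_orbitPoly_coeff_one f).choose
      map_add' := fun f₁ f₂ => Subtype.ext <| funext fun g => by
        have e := fun f => (hh.exists_orbitPoly_coeff_one f).choose_spec g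
        refine (e _).trans ?_
        rw [orbitPoly_add, coeff_add, ← e, ← e]
        rfl
      map_smul' := fun c f => Subtype.ext <| funext fun g => by
        have e := fun f => (hh.exists_orbitPoly_coeff_one f).choose_spec g
        refine (e _).trans ?_
        rw [orbitPoly_smul, coeff_smul, ← e]
        rfl }
    fun f₁ f₂ => Subtype.ext <| funext fun g => by
      have e := fun f => (hh.exists_orbitPoly_coeff_one f).choose_spec g
      refine (e _).trans ?_
      rw [orbitPoly_mul, mul_coeff_one, orbitPoly_coeff_zero, orbitPoly_coeff_zero, ← e, ← e,
        mul_comm _ (f₂.1 g)]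
      rfl

theorem logDerivation_apply (f : CoordRing H) (g : H) :
    (hh.logDerivation f).1 g = (hh.orbitPoly f g).coeff 1 :=
  (hh.exists_orbitPoly_coeff_one f).choose_spec g

theorem orbitPoly_logDerivation (f : CoordRing H) (g : H) :
    hh.orbitPoly (hh.logDerivation f) g = derivative (hh.orbitPoly f g) :=
  eq_of_eval_natCast_eq fun m => by
    rw [orbitPoly_eval, logDerivation_apply, orbitPoly_mul_pow, taylor_coeff_one]

theorem orbitPoly_logDerivation_pow (f : CoordRing H) (g : H) (k : ℕ) :
    hh.orbitPoly ((hh.logDerivation.toLinearMap ^ k) f) g =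
      derivative^[k] (hh.orbitPoly f g) := by
  induction k with
  | zero => rfl
  | succ k ih =>
    rw [pow_succ', Module.End.mul_apply, Function.iterate_succ_apply', ← ih]
    exact hh.orbitPoly_logDerivation _ g

theorem orbitPoly_coeff (f : CoordRing H) (g : H) (k : ℕ) :
    (hh.orbitPoly f g).coeff k =
      ((k.factorial : ℂ)⁻¹) * ((hh.logDerivation.toLinearMap ^ k) f).1 g := by
  rw [coeff_eq_inv_factorial_mul_eval_iterate_derivative, ← orbitPoly_logDerivation_pow,
    ← coeff_zero_eq_eval_zero, orbitPoly_coeff_zero]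

theorem logDerivation_mem_lieAlgebra : hh.logDerivation ∈ lieAlgebra H := by
  intro a f
  refine Subtype.ext (funext fun g => ?_)
  rw [logDerivation_apply, orbitPoly_leftTranslate, ← logDerivation_apply]
  rfl

theorem exists_isExp {h : H} (hh : IsUnipotentElement h) : ∃ X : lieAlgebra H, IsExp X h := by
  refine ⟨⟨hh.logDerivation, hh.logDerivation_mem_lieAlgebra⟩, fun f => ?_⟩
  obtain ⟨n, hn⟩ := hh.exists_orbitPoly_coeff_eq_zero f
  refine ⟨n, Subtype.ext (funext fun g => ?_), ?_⟩
  · have := hn g n le_rfl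
    rw [orbitPoly_coeff] at this
    exact (mul_eq_zero.1 this).resolve_left (by simp [Nat.factorial_ne_zero])
  · have h1 := hh.orbitPoly_eval f 1 1
    rw [eval_eq_sum_range_of_coeff_eq_zero (hn 1)] at h1
    simpa [orbitPoly_coeff] using h1.symm

end IsUnipotentElement

/-! ### The exponential of a locally nilpotent derivation -/

section Exp

variable {D : Derivation ℂ (CoordRing H) (CoordRing H)}
  (hD : ∀ f : CoordRing H, ∃ n : ℕ, (D.toLinearMap ^ n) f = 0)

/-- The polynomial `∑ₖ (Dᵏ f)(1) tᵏ / k!`, which stands for `t ↦ f (exp (t D))`. -/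
noncomputable def expPoly (f : CoordRing H) : ℂ[X] :=
  ∑ k ∈ Finset.range (hD f).choose,
    monomial k (((k.factorial : ℂ)⁻¹) * ((D.toLinearMap ^ k) f).1 1)

theorem pow_apply_eq_zero_of_le {f : CoordRing H} {n k : ℕ} (hn : (D.toLinearMap ^ n) f = 0)
    (hk : n ≤ k) : (D.toLinearMap ^ k) f = 0 := by
  obtain ⟨j, rfl⟩ := Nat.exists_eq_add_of_le' hk
  rw [pow_add, Module.End.mul_apply, hn, map_zero]

theorem expPoly_coeff (f : CoordRing H) (k : ℕ) :
    (expPoly hD f).coeff k = ((k.factorial : ℂ)⁻¹) * ((D.toLinearMap ^ k) f).1 1 := by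
  simp only [expPoly, finsetSum_coeff, coeff_monomial, Finset.sum_ite_eq', Finset.mem_range]
  split_ifs with hk
  · rfl
  · rw [pow_apply_eq_zero_of_le (hD f).choose_spec (not_lt.1 hk)]
    simp

theorem expPoly_eval {f : CoordRing H} {n : ℕ} (hn : (D.toLinearMap ^ n) f = 0) (t : ℂ) :
    (expPoly hD f).eval t = ∑ k ∈ Finset.range n,
      ((k.factorial : ℂ)⁻¹) * ((D.toLinearMap ^ k) f).1 1 * t ^ k := by
  rw [eval_eq_sum_range_of_coeff_eq_zero (n := n) fun k hk => ?_]
  · simp only [expPoly_coeff]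
  · rw [expPoly_coeff, pow_apply_eq_zero_of_le hn hk]
    simp

theorem expPoly_mul (f₁ f₂ : CoordRing H) :
    expPoly hD (f₁ * f₂) = expPoly hD f₁ * expPoly hD f₂ := by
  ext k
  have := congrArg ((Pi.evalAlgHom ℂ (fun _ : H => ℂ) 1).comp
    (regular : Subalgebra ℂ (H → ℂ)).val) (D.inv_factorial_smul_pow_mul k f₁ f₂)
  simp only [map_sum, map_mul, map_smul] at this
  simp only [coeff_mul, expPoly_coeff]
  exact this

/-- The algebra homomorphism `f ↦ f (exp (t D))`. -/
noncomputable def expAlgHom (t : ℂ) : CoordRing H →ₐ[ℂ] ℂ :=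
  AlgHom.ofLinearMap
    { toFun := fun f => (expPoly hD f).eval t
      map_add' := fun f₁ f₂ => by
        rw [← eval_add]
        congr 1
        ext k
        simp [expPoly_coeff, mul_add]
      map_smul' := fun c f => by
        rw [RingHom.id_apply, smul_eq_mul, ← smul_eq_mul, ← eval_smul]
        congr 1
        ext k
        simp [expPoly_coeff, mul_left_comm] }
    (by
      change (expPoly hD 1).eval t = 1
      rw [expPoly_eval hD (n := 1) (by simp)]
      simp)
    (fun f₁ f₂ => by
      change (expPoly hD (f₁ * f₂)).eval t = (expPoly hD f₁).eval t * (expPoly hD f₂).eval t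
      rw [expPoly_mul, eval_mul])

theorem expPoly_pow_apply (f : CoordRing H) (k : ℕ) :
    expPoly hD ((D.toLinearMap ^ k) f) = derivative^[k] (expPoly hD f) := by
  induction k with
  | zero => rfl
  | succ k ih =>
    rw [pow_succ', Module.End.mul_apply, Function.iterate_succ_apply', ← ih]
    ext j
    rw [coeff_derivative, expPoly_coeff, expPoly_coeff, pow_succ, Module.End.mul_apply,
      Nat.factorial_succ]
    have := Nat.factorial_ne_zero j
    have : (j : ℂ) + 1 ≠ 0 := by exact_mod_cast j.succ_ne_zero
    push_cast
    field_simp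

/-- If `r = exp (s D)` and `D` is left invariant, then `f (r * exp (t D)) = f (exp ((t + s) D))`. -/
theorem expPoly_leftTranslate (hD' : D ∈ lieAlgebra H) {r : H} {s : ℂ}
    (hr : ∀ f : CoordRing H, f.1 r = (expPoly hD f).eval s) (f : CoordRing H) :
    expPoly hD (leftTranslate r f) = taylor s (expPoly hD f) := by
  ext k
  have hcomm : (D.toLinearMap ^ k) (leftTranslate r f) =
      leftTranslate r ((D.toLinearMap ^ k) f) := by
    induction k with
    | zero => rfl
    | succ k ih =>
      rw [pow_succ', Module.End.mul_apply, ih]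
      exact hD' r _
  have h1 : (leftTranslate r ((D.toLinearMap ^ k) f)).1 1 = ((D.toLinearMap ^ k) f).1 r :=
    congrArg ((D.toLinearMap ^ k) f).1 (mul_one r)
  rw [expPoly_coeff, hcomm, h1, hr, expPoly_pow_apply, taylor_coeff, ← factorial_smul_hasseDeriv]
  simp [Nat.factorial_ne_zero]

end Exp

variable {X : lieAlgebra H}

theorem isExp_smul_of_expPoly
    (hX : ∀ f : CoordRing H, ∃ n : ℕ,
      ((X : Derivation ℂ (CoordRing H) (CoordRing H)).toLinearMap ^ n) f = 0) {t : ℂ} {r : H}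
    (hr : ∀ f : CoordRing H, f.1 r = (expPoly hX f).eval t) : IsExp (t • X) r := by
  intro f
  obtain ⟨n, hn⟩ := hX f
  have hpow : ∀ k, (((t • X : lieAlgebra H) :
      Derivation ℂ (CoordRing H) (CoordRing H)).toLinearMap ^ k) f =
      t ^ k • ((X : Derivation ℂ (CoordRing H) (CoordRing H)).toLinearMap ^ k) f := by
    intro k
    rw [← LinearMap.smul_apply, ← _root_.smul_pow]
    rfl
  refine ⟨n, by rw [hpow, hn, smul_zero], ?_⟩
  rw [hr, expPoly_eval hX hn]
  refine Finset.sum_congr rfl fun k _ => ?_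
  rw [hpow, mul_assoc, mul_comm _ (t ^ k)]
  rfl

/-- If `h = exp X`, then `exp (½ X)` exists in `H` and is a square root of `h`. -/
theorem IsExp.exists_isExp_half {h : H} (hX : IsExp X h) :
    ∃ r : H, IsExp ((1 / 2 : ℂ) • X) r ∧ r ^ 2 = h := by
  have hX' := fun f => (hX f).imp fun _ => And.left
  obtain ⟨r, hr⟩ := exists_point (expAlgHom hX' (1 / 2))
  replace hr : ∀ f : CoordRing H, f.1 r = (expPoly hX' f).eval (1 / 2) := hr
  refine ⟨r, isExp_smul_of_expPoly hX' hr, eq_of_forall_regular_eq fun f => ?_⟩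
  obtain ⟨n, hn, hf⟩ := hX f
  have h1 : f.1 (r ^ 2) = (leftTranslate r f).1 r := congrArg f.1 (sq r)
  rw [h1, hr, expPoly_leftTranslate hX' X.2 hr, taylor_eval, expPoly_eval hX' hn, hf]
  norm_num

end ComplexAlgebraicGroup

/-! ### Splitting elements -/

section Splitting

variable {H E : Type*} [Group H] [Group E] {S : GroupExtension H E (ℂ ≃ₐ[ℝ] ℂ)}

theorem exists_inl_eq_sq {x : E} (hx : x ∈ preimageConj S) : ∃ h : H, S.inl h = x ^ 2 := by
  change x ^ 2 ∈ S.inl.range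
  rw [S.range_inl_eq_ker_rightHom, MonoidHom.mem_ker, map_pow, show S.rightHom x = _ from hx]
  ext z
  simp [sq]

theorem isSplittingElement_inv_mul (hsq : Function.Injective (fun h : H => h ^ 2)) {x : E}
    (hx : x ∈ preimageConj S) {r : H} (hr : S.inl (r ^ 2) = x ^ 2) :
    IsSplittingElement S ((S.inl r)⁻¹ * x) := by
  have hfix : S.conjAct x r = r := hsq <| S.inl_injective <| by
    change S.inl (S.conjAct x r ^ 2) = S.inl (r ^ 2)
    rw [← map_pow, S.inl_conjAct_comm, hr]
    group
  have hcomm : Commute (S.inl r) x := by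
    have := S.inl_conjAct_comm (e := x) (n := r)
    rw [hfix] at this
    exact eq_mul_inv_iff_mul_eq.1 this
  refine ⟨?_, ?_⟩
  · change S.rightHom _ = _
    rw [map_mul, map_inv, S.rightHom_inl, inv_one, one_mul]
    exact hx
  · rw [hcomm.inv_left.mul_pow, ← hr, map_pow, inv_pow, inv_mul_cancel]

theorem isConj_of_isSplittingElement (hsq : Function.Bijective (fun h : H => h ^ 2)) {x y : E}
    (hx : IsSplittingElement S x) (hy : IsSplittingElement S y) : IsConj x y := by
  obtain ⟨h, hh⟩ : y * x⁻¹ ∈ S.inl.range := by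
    rw [S.range_inl_eq_ker_rightHom, MonoidHom.mem_ker, map_mul, map_inv,
      show S.rightHom x = _ from hx.1, show S.rightHom y = _ from hy.1, mul_inv_cancel]
  obtain ⟨r, hr⟩ := hsq.2 h
  have hx2 : x⁻¹ = x := inv_eq_of_mul_eq_one_left (by rw [← sq, hx.2])
  have hy2 : y⁻¹ = y := inv_eq_of_mul_eq_one_left (by rw [← sq, hy.2])
  have hneg : S.conjAct x r = r⁻¹ := hsq.1 <| S.inl_injective <| by
    change S.inl (S.conjAct x r ^ 2) = S.inl (r⁻¹ ^ 2)
    rw [← map_pow, S.inl_conjAct_comm, inv_pow, map_inv, show r ^ 2 = h from hr, hh, mul_inv_rev,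
      inv_inv, hy2, mul_assoc, mul_assoc, ← mul_inv_rev, ← sq, hx.2, inv_one, mul_one]
  have hconj := S.inl_conjAct_comm (e := x) (n := r)
  rw [hneg, map_inv, hx2] at hconj
  refine isConj_iff.2 ⟨S.inl r, ?_⟩
  have hxr : x * (S.inl r)⁻¹ = S.inl r * x := by
    rw [hconj, ← mul_assoc, ← mul_assoc, ← sq, hx.2, one_mul]
  rw [mul_assoc, hxr, ← mul_assoc, ← sq, ← map_pow, show r ^ 2 = h from hr, hh,
    inv_mul_cancel_right]

end Splitting

end

theorem mainTheorem6 {H E : Type*} [Group H] [Group E] [ComplexAlgebraicGroup H]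
    (hH : ComplexAlgebraicGroup.IsUnipotent H)
    (S : GroupExtension H E (ℂ ≃ₐ[ℝ] ℂ))
    (hS : ∀ x ∈ preimageConj S, ComplexAlgebraicGroup.IsAntiRegular (S.conjAct x)) :
    (∃ x : E, IsSplittingElement S x) ∧
    (∀ x y : E, IsSplittingElement S x → IsSplittingElement S y → IsConj x y) ∧
    (∀ x ∈ preimageConj S, ∃ h : H, S.inl h = x ^ 2 ∧
      (∃ X : ComplexAlgebraicGroup.lieAlgebra H, ComplexAlgebraicGroup.IsExp X h) ∧
      ∀ X : ComplexAlgebraicGroup.lieAlgebra H, ComplexAlgebraicGroup.IsExp X h →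
        ∃ r : H, ComplexAlgebraicGroup.IsExp ((1 / 2 : ℂ) • X) r ∧
          IsSplittingElement S ((S.inl r)⁻¹ * x)) := by
  have hsq := hH.sq_injective
  have hroot : Function.Bijective (fun h : H => h ^ 2) := ⟨hsq, fun h => by
    obtain ⟨X, hX⟩ := (hH h).exists_isExp
    obtain ⟨r, -, hr⟩ := hX.exists_isExp_half
    exact ⟨r, hr⟩⟩
  refine ⟨?_, fun x y hx hy => isConj_of_isSplittingElement hroot hx hy, fun x hx => ?_⟩
  · obtain ⟨x, hx⟩ := S.rightHom_surjective Complex.conjAe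
    obtain ⟨h, hh⟩ := exists_inl_eq_sq (S := S) hx
    obtain ⟨r, rfl⟩ := hroot.2 h
    exact ⟨_, isSplittingElement_inv_mul hsq hx hh⟩
  · obtain ⟨h, hh⟩ := exists_inl_eq_sq hx
    refine ⟨h, hh, (hH h).exists_isExp, fun X hX => ?_⟩
    obtain ⟨r, hXr, rfl⟩ := hX.exists_isExp_half
    exact ⟨r, hXr, isSplittingElement_inv_mul hsq hx hh⟩
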